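/- A \emph{braided set} is a nonempty set $X$ with a bijection $R\colon X\times X\to X\times X$ satisfying $(R\times\mathrm{id})(\mathrm{id}\times R)(R\times\mathrm{id})=(\mathrm{id}\times R)(R\times\mathrm{id})(\mathrm{id}\times R)$ on $X^3$. It is \emph{self-distributive} if $R(x,y)$ has first coordinate $y$ for all $x,y\in X$ (write $R(x,y)=(y,x^y)$; equivalently, $X$ is a nonempty rack), and \emph{squarefree} if $R(x,x)=(x,x)$ for all $x\in X$; a squarefree self-distributive braided set is the same as a nonempty quandle. Its \emph{connected components} are the classes of the smallest equivalence relation $\sim$ such that $x\sim w$ and $y\sim z$ whenever $R(x,y)=(z,w)$. The braided subset $\langle x_1,\dots,x_n\rangle$ generated by $x_1,\dots,x_n$ is the intersection of all subsets $X_0\subseteq X$ that contain $x_1,\dots,x_n$ and for which $R$ restricts to a bijection $X_0\times X_0\to X_0\times X_0$. The braid group $$B_n=\langle \sigma_1,\dots,\sigma_{n-1} : \sigma_i\sigma_j=\sigma_j\sigma_i \ (i>j+1),\ \sigma_i\sigma_{i+1}\sigma_i=\sigma_{i+1}\sigma_i\sigma_{i+1}\ (i<n-1)\rangle$$ acts on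 $X^n$ from the right by $(x_1,\dots,x_n)^{\sigma_i}=(x_1,\dots,x_{i-1},R(x_i,x_{i+1}),x_{i+2},\dots,x_n)$, and maps to the symmetric group $S_n$ by $\sigma_i\mapsto(i\ \,i+1)$. \textbf{Corollary.} There is a function $N\colon\mathbb N\to\mathbb N$ such that the following holds. Let $X$ be a finite squarefree self-distributive braided set (that is, a nonempty finite quandle) with connected components $C_1,\dots,C_k$, let $s=(x_1,\dots,x_n)\in X^n$, and put $D_j=\{1\le i\le n : x_i\in C_j\}$ and $n_j=|D_j|$ for $1\le j\le k$. Identify $$S_{n_1}\times\dots\times S_{n_k}=\{\sigma\in S_n:\sigma(D_j)=D_j\text{ for every }1\le j\le k\},$$ and let $B_{n_1,\dots,n_k}$ be the inverse image of this subgroup in $B_n$. Suppose that $n_j\ge N(|X|)$ for every $1\le j\le k$ and that $\langle x_1,\dots,x_n\rangle=X$. Then the image in $S_n$ of the stabilizer of $s$ in $B_n$ is equal to $S_{n_1}\times\dots\times S_{n_k}$, and the same holds for the image of the stabilizer of $s$ in $B_{n_1,\dots,n_k}$. -/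

import Mathlib

universe u

/-- The map `R × id` on `X × X × X`. -/
def prodId {X : Type u} (R : X × X → X × X) : X × X × X → X × X × X :=
  fun p => ((R (p.1, p.2.1)).1, (R (p.1, p.2.1)).2, p.2.2)

/-- The map `id × R` on `X × X × X`. -/
def idProd {X : Type u} (R : X × X → X × X) : X × X × X → X × X × X :=
  fun p => (p.1, R p.2)

/-- A braided set: a nonempty set `X` with a bijection `R` of `X × X` that solves the
set-theoretic Yang--Baxter equation. -/
class BraidedSet (X : Type u) where
  nonempty : Nonempty X
  R : X × X ≃ X × X
  yang_baxter : prodId R ∘ idProd R ∘ prodId R = idProd R ∘ prodId R ∘ idProd R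

namespace BraidedSet

/-- Self-distributivity: `R (x, y) = (y, x ^ y)`. Self-distributive braided sets are the same
thing as (nonempty) racks. -/
def IsSelfDistributive (X : Type u) [BraidedSet X] : Prop :=
  ∀ x y : X, (R (x, y)).1 = y

/-- A self-distributive braided set is squarefree if and only if the rack is a quandle. -/
def IsSquarefree (X : Type u) [BraidedSet X] : Prop :=
  ∀ x : X, R (x, x) = (x, x)

/-- `X₀` is a braided subset of `X`: `R` restricts to a bijection of `X₀ × X₀`. -/
def IsBraidedSubset {X : Type u} [BraidedSet X] (X₀ : Set X) : Prop :=
  Set.BijOn (R : X × X → X × X) (X₀ ×ˢ X₀) (X₀ ×ˢ X₀)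

/-- The braided subset generated by `S`. -/
def generated {X : Type u} [BraidedSet X] (S : Set X) : Set X :=
  ⋂₀ {X₀ | IsBraidedSubset X₀ ∧ S ⊆ X₀}

/-- The smallest equivalence relation `∼` with `x ∼ w` and `y ∼ z` whenever
`R (x, y) = (z, w)`. -/
def componentSetoid (X : Type u) [BraidedSet X] : Setoid X :=
  Relation.EqvGen.setoid fun a b =>
    (∃ y z : X, R (a, y) = (z, b)) ∨ (∃ x w : X, R (x, a) = (b, w))

/-- The set of connected components of `X` (the trivialization of `X`). -/
def Components (X : Type u) [BraidedSet X] : Type u :=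
  Quotient (componentSetoid X)

/-- The connected component of an element. -/
def component {X : Type u} [BraidedSet X] (x : X) : Components X :=
  Quotient.mk (componentSetoid X) x

end BraidedSet

/-- The indices `i` (counted from `0`) of the standard generators `σ_i` of the braid group on
`n` strands; `σ_i` braids the strands `i` and `i + 1`. -/
abbrev BraidIndex (n : ℕ) : Type := {i : ℕ // i + 1 < n}

namespace BraidIndex

/-- The position `i`. -/
def left {n : ℕ} (i : BraidIndex n) : Fin n := ⟨i.1, Nat.lt_of_succ_lt i.2⟩

/-- The position `i + 1`. -/
def right {n : ℕ} (i : BraidIndex n) : Fin n := ⟨i.1 + 1, i.2⟩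

end BraidIndex

/-- The relators of Artin's presentation. -/
def braidRelators (n : ℕ) : Set (FreeGroup (BraidIndex n)) :=
  {r | ∃ i j : BraidIndex n, j.1 + 1 < i.1 ∧
      r = (FreeGroup.of i * FreeGroup.of j) * (FreeGroup.of j * FreeGroup.of i)⁻¹} ∪
  {r | ∃ i j : BraidIndex n, j.1 = i.1 + 1 ∧
      r = (FreeGroup.of i * FreeGroup.of j * FreeGroup.of i) *
        (FreeGroup.of j * FreeGroup.of i * FreeGroup.of j)⁻¹}

/-- The braid group `B_n` on `n` strands. -/
abbrev BraidGroup (n : ℕ) : Type := PresentedGroup (braidRelators n)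

namespace BraidGroup

/-- The homomorphism `B_n → S_n` with `σ_i ↦ (i  i+1)`. -/
def toPerm (n : ℕ) : BraidGroup n →* Equiv.Perm (Fin n) :=
  PresentedGroup.toGroup (f := fun i : BraidIndex n => Equiv.swap i.left i.right) (by
    rintro r (⟨i, j, hij, rfl⟩ | ⟨i, j, hij, rfl⟩)
    all_goals
      obtain ⟨i, hi⟩ := i
      obtain ⟨j, hj⟩ := j
      simp only [map_mul, map_inv, FreeGroup.lift_apply_of, mul_inv_eq_one]
      ext k
      simp only [Equiv.Perm.mul_apply, Equiv.swap_apply_def, BraidIndex.left, BraidIndex.right]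
      grind)

/-- The map `(x_1, …, x_n) ↦ (x_1, …, R (x_i, x_{i+1}), …, x_n)`, for any map `R`. -/
def applyAt {X : Type u} {n : ℕ} (R : X × X → X × X) (i : BraidIndex n) (x : Fin n → X) :
    Fin n → X :=
  fun k => if k = i.left then (R (x i.left, x i.right)).1
    else if k = i.right then (R (x i.left, x i.right)).2
    else x k

theorem applyAt_inverse {X : Type u} {n : ℕ} (R S : X × X → X × X)
    (h : ∀ p, S (R p) = p) (i : BraidIndex n) (x : Fin n → X) :
    applyAt S i (applyAt R i x) = x := by
  have hne : i.right ≠ i.left := by simp [BraidIndex.left, BraidIndex.right]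
  have e := h (x i.left, x i.right)
  funext k
  simp only [applyAt, if_neg hne, if_true]
  rw [Prod.mk.eta, e]
  split_ifs with h1 h2 <;> simp_all

theorem applyAt_comm {X : Type u} {n : ℕ} (R : X × X → X × X) (i j : BraidIndex n)
    (hij : j.1 + 1 < i.1) (x : Fin n → X) :
    applyAt R i (applyAt R j x) = applyAt R j (applyAt R i x) := by
  obtain ⟨i, hi⟩ := i
  obtain ⟨j, hj⟩ := j
  funext k
  simp only [applyAt, BraidIndex.left, BraidIndex.right, Fin.ext_iff] at hij ⊢
  grind

theorem applyAt_braid {X : Type u} {n : ℕ} (R : X × X → X × X)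
    (h : prodId R ∘ idProd R ∘ prodId R = idProd R ∘ prodId R ∘ idProd R)
    (i j : BraidIndex n) (hij : j.1 = i.1 + 1) (x : Fin n → X) :
    applyAt R i (applyAt R j (applyAt R i x)) = applyAt R j (applyAt R i (applyAt R j x)) := by
  obtain ⟨i, hi⟩ := i
  obtain ⟨j, hj⟩ := j
  simp only at hij
  subst hij
  have e := congrFun h (x ⟨i, by omega⟩, x ⟨i + 1, by omega⟩, x ⟨i + 2, by omega⟩)
  simp only [Function.comp_apply, prodId, idProd, Prod.ext_iff] at e
  obtain ⟨e1, e2, e3⟩ := e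
  funext k
  simp only [applyAt, BraidIndex.left, BraidIndex.right, Fin.ext_iff]
  grind

/-- The bijection of `X ^ n` by which `σ_i` acts. -/
def generatorPerm (X : Type u) [BraidedSet X] {n : ℕ} (i : BraidIndex n) :
    Equiv.Perm (Fin n → X) where
  toFun := applyAt BraidedSet.R i
  invFun := applyAt BraidedSet.R.symm i
  left_inv := applyAt_inverse _ _ (Equiv.symm_apply_apply _) i
  right_inv := applyAt_inverse _ _ (Equiv.apply_symm_apply _) i

/-- The right action of `B_n` on `X ^ n`, as a homomorphism to the opposite of the group of
permutations of `X ^ n`. -/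
def rightAction (X : Type u) [BraidedSet X] (n : ℕ) :
    BraidGroup n →* (Equiv.Perm (Fin n → X))ᵐᵒᵖ :=
  PresentedGroup.toGroup (f := fun i : BraidIndex n => MulOpposite.op (generatorPerm X i)) (by
    rintro r (⟨i, j, hij, rfl⟩ | ⟨i, j, hij, rfl⟩)
    all_goals
      simp only [map_mul, map_inv, FreeGroup.lift_apply_of, mul_inv_eq_one]
      apply MulOpposite.unop_injective
      ext1 x
    · exact (applyAt_comm _ i j hij x).symm
    · exact applyAt_braid _ BraidedSet.yang_baxter i j hij x)

/-- The tuple `s ^ g`. -/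
def act {X : Type u} [BraidedSet X] {n : ℕ} (s : Fin n → X) (g : BraidGroup n) : Fin n → X :=
  (rightAction X n g).unop s

/-- The stabilizer of `s` in `B_n`. -/
def stabilizer {X : Type u} [BraidedSet X] {n : ℕ} (s : Fin n → X) : Subgroup (BraidGroup n) where
  carrier := {g | act s g = s}
  one_mem' := by simp [act]
  mul_mem' {a b} ha hb := by
    simp only [Set.mem_ofPred_eq, act, map_mul, MulOpposite.unop_mul,
      Equiv.Perm.mul_apply] at ha hb ⊢
    rw [ha, hb]
  inv_mem' {a} ha := by
    simp only [Set.mem_ofPred_eq, act, map_inv, MulOpposite.unop_inv] at ha ⊢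
    rw [Equiv.Perm.inv_eq_iff_eq, ha]

end BraidGroup

namespace BraidedSet

/-- For a component `c = C_j`, the set `D_j` of indices `i` with `x_i ∈ C_j`;
its cardinality is `n_j`. -/
def indices {X : Type u} [BraidedSet X] {n : ℕ} (s : Fin n → X) (c : Components X) :
    Set (Fin n) :=
  {i | component (s i) = c}

/-- The subgroup `S_{n_1} × ⋯ × S_{n_k}` of `S_n`, consisting of the permutations `σ` with
`σ (D_j) = D_j` for every `j`. -/
def productSubgroup {X : Type u} [BraidedSet X] {n : ℕ} (s : Fin n → X) :
    Subgroup (Equiv.Perm (Fin n)) where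
  carrier := {σ | ∀ c : Components X, σ '' indices s c = indices s c}
  one_mem' c := by simp
  mul_mem' {a b} ha hb c := by
    rw [Equiv.Perm.coe_mul, Set.image_comp, hb c, ha c]
  inv_mem' {a} ha c := by
    conv_lhs => rw [← ha c]
    rw [← Set.image_comp]
    simp

/-- The subgroup `B_{n_1, …, n_k}` of `B_n`, the inverse image of `S_{n_1} × ⋯ × S_{n_k}`. -/
def coloredBraidGroup {X : Type u} [BraidedSet X] {n : ℕ} (s : Fin n → X) :
    Subgroup (BraidGroup n) :=
  (productSubgroup s).comap (BraidGroup.toPerm n)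

end BraidedSet

/-! Attach to each strand of `s` its position as a label, and multiply the strands in the monoid
with relations `e (x, a) * e (y, b) = e (y, b) * e (y ◃ x, a)`. These relations are single
crossings, so two labelled tuples with the same product differ by a braid
(`braidRel_of_ofTuple_eq`). Hence `σ` comes from the stabilizer of `s` as soon as relabelling by `σ`
fixes the element `m` of `s`. Conversely, a braid moves components along its permutation, which
bounds the image from above.

Let `d = |X|!`, so that `d`-th powers of the inner actions are trivial. A cable of `d` parallel
strands of one color is then central, and in front of an element whose colors generate `X` it can be
recolored within its orbit (`Generates.cable_mul_eq`). With many strands in every orbit, the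
pigeonhole principle thus splits off cables of any prescribed colors
(`Generates.exists_isCableProd_mul`).

Take the colors `U V V U`, where `U` lists `X` and `V` repeats it `|X|` times. A strand moved past a
block `V` can reach every color in its orbit (`IsCableProd.rich`). Two strands of one orbit on
opposite sides of such a block can therefore meet with equal colors, and there `x ◃ x = x` allows
their labels to be exchanged. Using both blocks gives all transpositions inside an orbit, hence the
whole product of symmetric groups. -/

open scoped Quandles

/-! ### The labelled structure monoid of a quandle and its cables. -/

section Quandle

variable {X : Type*} [Quandle X] {ι : Type*}

/-- The orbits of a quandle under its inner automorphisms. -/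
abbrev QuandleOrbit (X : Type*) [Quandle X] : Type _ := Quot fun x y : X => ∃ z, z ◃ x = y

theorem QuandleOrbit.mk_act (x y : X) :
    (Quot.mk _ (y ◃ x) : QuandleOrbit X) = Quot.mk _ x :=
  (Quot.sound ⟨y, rfl⟩).symm

/-- The subsets of a quandle that are closed under the action of their elements and its
inverse. -/
def IsSubquandle (S : Set X) : Prop := ∀ y ∈ S, ∀ x, y ◃ x ∈ S ↔ x ∈ S

/-- The relations `e (x, a) * e (y, b) = e (y, b) * e (y ◃ x, a)` between strands
of color `x` and label `a`. -/
inductive StrandRel (X ι : Type*) [Quandle X] :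
    FreeMonoid (X × ι) → FreeMonoid (X × ι) → Prop
  | cross (x y : X) (a b : ι) : StrandRel X ι
      (FreeMonoid.of (x, a) * FreeMonoid.of (y, b))
      (FreeMonoid.of (y, b) * FreeMonoid.of (y ◃ x, a))

/-- The structure monoid of a quandle, with labelled generators. -/
abbrev StrandMonoid (X ι : Type*) [Quandle X] : Type _ := PresentedMonoid (StrandRel X ι)

/-- The generator of color `x` and label `a`. -/
def strand (x : X) (a : ι) : StrandMonoid X ι := PresentedMonoid.of _ (x, a)

namespace StrandMonoid

theorem strand_mul_strand (x y : X) (a b : ι) :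
    strand x a * strand y b = strand y b * strand (y ◃ x) a :=
  PresentedMonoid.mk_eq_mk_of_rel (.cross x y a b)

theorem exists_list (m : StrandMonoid X ι) :
    ∃ L : List (X × ι), m = (L.map fun p => strand p.1 p.2).prod := by
  obtain ⟨L, rfl⟩ := PresentedMonoid.surjective_mk m
  refine ⟨L.toList, ?_⟩
  induction L with
  | one => simp
  | of x => simp [strand, PresentedMonoid.of]
  | mul x y hx hy => simp [hx, hy]

/-- The homomorphism with given values on the strands. -/
def lift {N : Type*} [Monoid N] (f : X → ι → N)
    (h : ∀ x y a b, f x a * f y b = f y b * f (y ◃ x) a) : StrandMonoid X ι →* N :=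
  PresentedMonoid.lift (fun p => f p.1 p.2) (by
    rintro _ _ ⟨x, y, a, b⟩
    simpa using h x y a b)

@[simp]
theorem lift_strand {N : Type*} [Monoid N] (f : X → ι → N)
    (h : ∀ x y a b, f x a * f y b = f y b * f (y ◃ x) a) (x : X) (a : ι) :
    lift f h (strand x a) = f x a := rfl

/-- The multiset of the pairs of orbit and label that occur. -/
def content : StrandMonoid X ι →* Multiplicative (Multiset (QuandleOrbit X × ι)) :=
  lift (fun x a => .ofAdd {(Quot.mk _ x, a)}) fun x y a b => by
    rw [QuandleOrbit.mk_act, mul_comm]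

@[simp]
theorem content_strand (x : X) (a : ι) :
    content (strand x a) = .ofAdd {(Quot.mk _ x, a)} := rfl

open Classical in
/-- The indicator of the submonoid of the elements that have all their colors in `S`. -/
noncomputable def colorsIn {S : Set X} (hS : IsSubquandle S) : StrandMonoid X ι →* ℕ :=
  lift (fun x _ => if x ∈ S then 1 else 0) fun x y a b => by
    by_cases hy : y ∈ S
    · simp [hy, hS y hy x]
    · simp [hy]

theorem colorsIn_strand {S : Set X} (hS : IsSubquandle S) {x : X} (hx : x ∈ S) (a : ι) :
    colorsIn hS (strand x a) = 1 := by
  simp [colorsIn, hx]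

theorem mem_of_colorsIn_strand {S : Set X} (hS : IsSubquandle S) {x : X} {a : ι}
    (h : colorsIn hS (strand x a) = 1) : x ∈ S := by
  by_contra hx
  simp [colorsIn, hx] at h

theorem colorsIn_prod {S : Set X} (hS : IsSubquandle S) (L : List (X × ι))
    (h : ∀ p ∈ L, p.1 ∈ S) : colorsIn hS (L.map fun p => strand p.1 p.2).prod = 1 := by
  rw [map_list_prod, List.map_map]
  refine List.prod_eq_one fun n hn => ?_
  obtain ⟨p, hp, rfl⟩ := List.mem_map.1 hn
  exact colorsIn_strand hS (h p hp) p.2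

/-- The colors of the element generate the quandle. -/
def Generates (m : StrandMonoid X ι) : Prop :=
  ∀ (S : Set X) (hS : IsSubquandle S), colorsIn hS m = 1 → S = Set.univ

/-- The product of parallel strands of the same color. -/
def cable (x : X) (l : List ι) : StrandMonoid X ι := (l.map (strand x)).prod

@[simp] theorem cable_nil (x : X) : cable x ([] : List ι) = 1 := rfl

@[simp] theorem cable_cons (x : X) (a : ι) (l : List ι) :
    cable x (a :: l) = strand x a * cable x l := by simp [cable]

theorem cable_append (x : X) (l l' : List ι) :
    cable x (l ++ l') = cable x l * cable x l' := by simp [cable]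

theorem content_cable (x : X) (l : List ι) :
    (content (cable x l)).toAdd = ((l : Multiset ι).map fun a => (Quot.mk _ x, a)) := by
  induction l with
  | nil => rfl
  | cons a l ih => simp [ih]

theorem colorsIn_cable {S : Set X} (hS : IsSubquandle S) {x : X} (hx : x ∈ S) (l : List ι) :
    colorsIn hS (cable x l) = 1 := by
  induction l with
  | nil => simp
  | cons a l ih => simp [ih, colorsIn_strand hS hx]

theorem cable_mul_strand (x y : X) (l : List ι) (b : ι) :
    cable x l * strand y b = strand y b * cable (y ◃ x) l := by
  induction l with
  | nil => simp
  | cons a l ih => rw [cable_cons, mul_assoc, ih, ← mul_assoc, strand_mul_strand, cable_cons,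
      mul_assoc]

theorem strand_mul_cable (x y : X) (l : List ι) (b : ι) :
    strand y b * cable x l = cable x l * strand ((Rack.act' x ^ l.length) y) b := by
  induction l generalizing y with
  | nil => simp
  | cons a l ih =>
    rw [cable_cons, ← mul_assoc, strand_mul_strand, mul_assoc, ih, mul_assoc, List.length_cons,
      pow_succ, Equiv.Perm.mul_apply, Rack.act'_apply]

/-- Strands of color `y` keep their color while they are collected on the left; the strands that
they pass change color instead. -/
theorem exists_cable_mul [DecidableEq X] (y : X) (L : List (X × ι)) (k : ℕ)
    (hk : k ≤ (L.map Prod.fst).count y) :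
    ∃ (l : List ι) (m : StrandMonoid X ι), l.length = k ∧
      (L.map fun p => strand p.1 p.2).prod = cable y l * m := by
  induction L generalizing k with
  | nil => exact ⟨[], 1, by simp_all⟩
  | cons p L ih =>
    obtain ⟨x, a⟩ := p
    rw [List.map_cons, List.count_cons] at hk
    by_cases hx : x = y
    · subst hx
      obtain _ | k := k
      · exact ⟨[], _, rfl, (one_mul _).symm⟩
      · obtain ⟨l, m, hl, h⟩ := ih k (by simpa using hk)
        exact ⟨a :: l, m, by simp [hl], by simp [h, mul_assoc]⟩
    · obtain ⟨l, m, hl, h⟩ := ih k (by simpa [hx] using hk)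
      refine ⟨l, strand ((Rack.act' y ^ l.length) x) a * m, hl, ?_⟩
      rw [List.map_cons, List.prod_cons, h, ← mul_assoc, strand_mul_cable, mul_assoc]

open Classical in
/-- The number of strands with color in the orbit `c`. -/
noncomputable def orbitCount (c : QuandleOrbit X) (m : StrandMonoid X ι) : ℕ :=
  ((content m).toAdd.map Prod.fst).count c

@[simp]
theorem orbitCount_mul (c : QuandleOrbit X) (m m' : StrandMonoid X ι) :
    orbitCount c (m * m') = orbitCount c m + orbitCount c m' := by
  simp [orbitCount]

theorem orbitCount_cable_le (c : QuandleOrbit X) (x : X) (l : List ι) :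
    orbitCount c (cable x l) ≤ l.length := by
  classical
  rw [orbitCount]
  refine (Multiset.count_le_card _ _).trans ?_
  simp [content_cable]

theorem content_prod (L : List (X × ι)) :
    (content (L.map fun p => strand p.1 p.2).prod).toAdd =
      ((L : Multiset (X × ι)).map fun p => (Quot.mk _ p.1, p.2)) := by
  induction L with
  | nil => rfl
  | cons a l ih => simp [ih]

/-- Pigeonhole: the strands of one orbit are distributed over at most `|X|` colors. -/
theorem exists_color_le_count [Fintype X] [DecidableEq X] (c : QuandleOrbit X)
    (L : List (X × ι)) (k : ℕ)
    (h : Fintype.card X * k ≤ orbitCount c (L.map fun p => strand p.1 p.2).prod) :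
    ∃ y : X, Quot.mk _ y = c ∧ k ≤ (L.map Prod.fst).count y := by
  classical
  obtain ⟨x, rfl⟩ := Quot.exists_rep c
  by_contra! hlt
  have hk : ∀ y : X, (Quot.mk _ y : QuandleOrbit X) = Quot.mk _ x →
      (L.map Prod.fst).count y < k := hlt
  have hkey : orbitCount (Quot.mk _ x) (L.map fun p => strand p.1 p.2).prod =
      ∑ y : X, if (Quot.mk _ y : QuandleOrbit X) = Quot.mk _ x
        then (L.map Prod.fst).count y else 0 := by
    rw [orbitCount, content_prod]
    clear h hlt hk
    induction L with
    | nil => simp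
    | cons p L ih =>
      simp only [Multiset.map_coe, List.map_map, Multiset.coe_count, List.map_cons,
        List.count_cons] at ih ⊢
      rw [ih]
      have : ∀ y : X, (if (Quot.mk _ y : QuandleOrbit X) = Quot.mk _ x then
          (L.map Prod.fst).count y + (if p.1 == y then 1 else 0) else 0) =
          (if (Quot.mk _ y : QuandleOrbit X) = Quot.mk _ x then (L.map Prod.fst).count y else 0) +
          (if p.1 = y then
            (if (Quot.mk _ p.1 : QuandleOrbit X) = Quot.mk _ x then 1 else 0) else 0) := by
        intro y
        by_cases hy : p.1 = y
        · subst hy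
          simp only [beq_self_eq_true, if_true]
          split_ifs <;> simp
        · simp [hy]
      simp only [this, Finset.sum_add_distrib, Finset.sum_ite_eq, Finset.mem_univ, if_true]
      simp
  rw [hkey] at h
  have hlt' : (∑ y : X, if (Quot.mk _ y : QuandleOrbit X) = Quot.mk _ x
        then (L.map Prod.fst).count y else 0) < ∑ _y : X, k := by
    refine Finset.sum_lt_sum_of_nonempty ⟨x, Finset.mem_univ _⟩ fun y _ => ?_
    split_ifs with hy
    · exact hk y hy
    · exact (Nat.zero_le _).trans_lt (hk x rfl)
  simp only [Finset.sum_const, Finset.card_univ, smul_eq_mul] at hlt'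
  omega

end StrandMonoid

end Quandle

/-! ### Central cables, recoloring, and transport of strands. -/

section Quandle

variable {X : Type*} [Quandle X] {ι : Type*}

namespace StrandMonoid

/-- Passing the cable changes the color of a strand by `act' x ^ l.length`, which is trivial here.
-/
theorem mul_cable_comm {x : X} {l : List ι} (hl : Rack.act' x ^ l.length = 1)
    (m : StrandMonoid X ι) : m * cable x l = cable x l * m := by
  obtain ⟨L, rfl⟩ := exists_list m
  induction L with
  | nil => simp
  | cons p L ih =>
    rw [List.map_cons, List.prod_cons, mul_assoc, ih, ← mul_assoc, strand_mul_cable, hl,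
      mul_assoc, Equiv.Perm.one_apply]

/-- The cable is recolored when the strand crosses it, and centrality brings the recolored cable
back. -/
theorem cable_mul_strand_eq {l : List ι} (hl : ∀ x : X, Rack.act' x ^ l.length = 1) (x z : X)
    (b : ι) : cable x l * strand z b = cable (z ◃ x) l * strand z b := by
  rw [cable_mul_strand, mul_cable_comm (hl _)]

theorem Generates.cable_mul_eq {d : ℕ} (hd : ∀ x : X, Rack.act' x ^ d = 1)
    {m : StrandMonoid X ι} (hm : Generates m) {x y : X}
    (hxy : (Quot.mk _ x : QuandleOrbit X) = Quot.mk _ y) {l : List ι} (hl : l.length = d) :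
    cable x l * m = cable y l * m := by
  subst hl
  -- The elements whose action on the cable's color cannot be seen in front of `m` form a
  -- subquandle. It contains every color of `m`, because the cable can be moved next to that strand,
  -- so it is all of `X`.
  let S : Set X := {z | ∀ x : X, cable x l * m = cable (z ◃ x) l * m}
  have hS : IsSubquandle S := by
    intro w hw z
    constructor
    · intro h u
      rw [hw u, h (w ◃ u), ← Shelf.self_distrib, ← hw]
    · intro h u
      obtain ⟨v, rfl⟩ := (Rack.act' w).surjective u
      rw [Rack.act'_apply, ← Shelf.self_distrib, ← hw v, ← hw, ← h]
  have hSm : colorsIn hS m = 1 := by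
    obtain ⟨L, hL⟩ := exists_list m
    rw [hL]
    refine colorsIn_prod hS L fun p hp x => ?_
    obtain ⟨L₁, L₂, rfl⟩ := List.append_of_mem hp
    have h : m = (L₁.map fun p => strand p.1 p.2).prod *
        (strand p.1 p.2 * (L₂.map fun p => strand p.1 p.2).prod) := by
      simpa using hL
    rw [h]
    generalize (L₁.map fun p => strand p.1 p.2).prod = P
    have hP : ∀ (u : X) (T : StrandMonoid X ι),
        cable u l * (P * T) = P * (cable u l * T) := fun u T => by
      rw [← mul_assoc, ← mul_cable_comm (hd u) P, mul_assoc]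
    rw [hP, hP, ← mul_assoc (cable x l), ← mul_assoc (cable _ l), cable_mul_strand_eq hd]
  have huniv := hm S hS hSm
  induction Quot.eqvGen_exact hxy with
  | rel u v h =>
    obtain ⟨z, rfl⟩ := h
    have hz : z ∈ S := huniv ▸ Set.mem_univ z
    exact hz u
  | refl => rfl
  | symm u v h ih => exact (ih hxy.symm).symm
  | trans u v w h h' ih ih' =>
    have huv : (Quot.mk _ u : QuandleOrbit X) = Quot.mk _ v := Quot.eqvGen_sound h
    exact (ih huv).trans (ih' (huv.symm.trans hxy))

/-- Moving `q` to the left of a strand of color `x` can change its color to `y`. -/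
def Transports (q : StrandMonoid X ι) (x y : X) : Prop :=
  ∃ q' : StrandMonoid X ι, ∀ a : ι, strand x a * q = q' * strand y a

theorem Transports.mul {q q' : StrandMonoid X ι} {x y z : X} (h : Transports q x y)
    (h' : Transports q' y z) : Transports (q * q') x z := by
  obtain ⟨r, hr⟩ := h
  obtain ⟨r', hr'⟩ := h'
  exact ⟨r * r', fun a => by rw [← mul_assoc, hr, mul_assoc, hr', mul_assoc]⟩

theorem transports_one (x : X) : Transports (1 : StrandMonoid X ι) x x :=
  ⟨1, fun a => by simp⟩

/-- The relation read from right to left: the other strand changes color instead. -/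
theorem transports_strand_self (x y : X) (b : ι) : Transports (strand y b) x x := by
  obtain ⟨z, rfl⟩ := (Rack.act' x).surjective y
  exact ⟨strand z b, fun a => (strand_mul_strand z x b a).symm⟩

theorem transports_strand_act (x y : X) (b : ι) : Transports (strand y b) x (y ◃ x) :=
  ⟨strand y b, fun a => strand_mul_strand x y a b⟩

theorem transports_self (q : StrandMonoid X ι) (x : X) : Transports q x x := by
  obtain ⟨L, rfl⟩ := exists_list q
  induction L with
  | nil => simpa using transports_one x
  | cons p L ih => simpa using (transports_strand_self x p.1 p.2).mul ih

/-- At each crossing one may choose which strand changes color; let the first `j` strands of the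
cable act and the others not. -/
theorem transports_cable (x y : X) (l : List ι) (j : ℕ) (hj : j ≤ l.length) :
    Transports (cable y l) x ((Rack.act' y ^ j) x) := by
  induction l generalizing x j with
  | nil =>
    obtain rfl : j = 0 := by simpa using hj
    exact transports_one x
  | cons a l ih =>
    rw [cable_cons]
    obtain _ | j := j
    · exact transports_self _ _
    · rw [pow_succ, Equiv.Perm.mul_apply]
      exact (transports_strand_act x y a).mul (ih _ j (by simpa using hj))

/-- The transported word `q'` does not depend on the label, and next to it the two strands both have
color `y`, so they commute by `y ◃ y = y`. -/
theorem Transports.swap {q : StrandMonoid X ι} {x y : X} (h : Transports q x y) (a b : ι) :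
    strand x a * q * strand y b = strand x b * q * strand y a := by
  obtain ⟨q', hq⟩ := h
  rw [hq, hq, mul_assoc, mul_assoc, strand_mul_strand, Quandle.fix]

/-- Products of cables of `d` strands with given colors. -/
inductive IsCableProd (ι : Type*) (d : ℕ) : List X → StrandMonoid X ι → Prop
  | nil : IsCableProd ι d [] 1
  | cons (x : X) (l : List ι) (W : List X) (q : StrandMonoid X ι) (hl : l.length = d)
      (hq : IsCableProd ι d W q) : IsCableProd ι d (x :: W) (cable x l * q)

theorem IsCableProd.exists_mul {d : ℕ} {W W' : List X} {q : StrandMonoid X ι}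
    (h : IsCableProd ι d (W ++ W') q) :
    ∃ q₁ q₂, IsCableProd ι d W q₁ ∧ IsCableProd ι d W' q₂ ∧ q = q₁ * q₂ := by
  induction W generalizing q with
  | nil => exact ⟨1, q, .nil, h, (one_mul q).symm⟩
  | cons x W ih =>
    obtain _ | ⟨_, l, _, q, hl, hq⟩ := h
    obtain ⟨q₁, q₂, h₁, h₂, rfl⟩ := ih hq
    exact ⟨_, q₂, .cons x l W q₁ hl h₁, h₂, (mul_assoc _ _ _).symm⟩

theorem IsCableProd.exists_eq_of_mem {d : ℕ} {W : List X} {q : StrandMonoid X ι}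
    (h : IsCableProd ι d W q) {x : X} (hx : x ∈ W) :
    ∃ (q₁ q₂ : StrandMonoid X ι) (l : List ι), l.length = d ∧ q = q₁ * cable x l * q₂ := by
  obtain ⟨W₁, W₂, rfl⟩ := List.append_of_mem hx
  obtain ⟨q₁, q', -, h', rfl⟩ := h.exists_mul
  obtain _ | ⟨_, l, _, q, hl, hq⟩ := h'
  exact ⟨q₁, q, l, hl, (mul_assoc _ _ _).symm⟩

theorem IsCableProd.transports {d : ℕ} {W : List X} {q : StrandMonoid X ι}
    (h : IsCableProd ι d W q) {z : X} (hz : z ∈ W) (x : X) (j : ℕ) (hj : j ≤ d) :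
    Transports q x ((Rack.act' z ^ j) x) := by
  obtain ⟨q₁, q₂, l, hl, rfl⟩ := h.exists_eq_of_mem hz
  exact ((transports_self q₁ x).mul (transports_cable x z l j (hl ▸ hj))).mul
    (transports_self q₂ _)

/-- The colors that occur in `q` can connect any two elements of the same orbit. -/
def Rich (q : StrandMonoid X ι) : Prop :=
  ∀ x y : X, (Quot.mk _ x : QuandleOrbit X) = Quot.mk _ y → Transports q x y

theorem Rich.mul_right {q : StrandMonoid X ι} (h : Rich q) (q' : StrandMonoid X ι) :
    Rich (q * q') := fun x y hxy => (h x y hxy).mul (transports_self q' y)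

theorem Rich.mul_left {q : StrandMonoid X ι} (h : Rich q) (q' : StrandMonoid X ι) :
    Rich (q' * q) := fun x y hxy => (transports_self q' x).mul (h x y hxy)

/-- Elements of one orbit are joined by a path with fewer than `|X|` edges, and each copy of `U`
realizes one edge. -/
theorem IsCableProd.rich [Fintype X] {d : ℕ} (hd₀ : 0 < d) (hd : ∀ x : X, Rack.act' x ^ d = 1)
    {U : List X} (hU : ∀ x, x ∈ U) {q : StrandMonoid X ι}
    (h : IsCableProd ι d (List.replicate (Fintype.card X) U).flatten q) : Rich q := by
  classical
  intro x y hxy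
  let G : SimpleGraph X := SimpleGraph.fromRel fun x y => ∃ z, z ◃ x = y
  have hG : G.Reachable x y := by
    induction Quot.eqvGen_exact hxy with
    | rel u v huv =>
      by_cases e : u = v
      · exact e ▸ .refl u
      · exact SimpleGraph.Adj.reachable ⟨e, Or.inl huv⟩
    | refl => exact .refl _
    | symm u v huv ih => exact (ih hxy.symm).symm
    | trans u v w h h' ih ih' =>
      have huv : (Quot.mk _ u : QuandleOrbit X) = Quot.mk _ v := Quot.eqvGen_sound h
      exact (ih huv).trans (ih' (huv.symm.trans hxy))
  have key : ∀ (k : ℕ) (x y : X) (p : G.Walk x y), p.length ≤ k → ∀ q : StrandMonoid X ι,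
      IsCableProd ι d (List.replicate k U).flatten q → Transports q x y := by
    intro k
    induction k with
    | zero =>
      intro x y p hp q hq
      obtain rfl := SimpleGraph.Walk.eq_of_length_eq_zero (Nat.le_zero.1 hp)
      exact transports_self q x
    | succ k ih =>
      intro x y p hp q hq
      cases p with
      | nil => exact transports_self q x
      | @cons _ v _ hxv p =>
        rw [List.replicate_succ, List.flatten_cons] at hq
        obtain ⟨q₁, q₂, h₁, h₂, rfl⟩ := hq.exists_mul
        refine Transports.mul ?_ (ih v y p (by simpa using hp) q₂ h₂)
        obtain ⟨z, rfl⟩ | ⟨z, rfl⟩ := hxv.2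
        · simpa using h₁.transports (hU z) x 1 hd₀
        -- An edge traversed backwards needs the inverse action of `z`, which is its power `d - 1`.
        · have := h₁.transports (hU z) (z ◃ v) (d - 1) (Nat.sub_le _ _)
          rwa [← Rack.act'_apply, ← Equiv.Perm.mul_apply, ← pow_succ, Nat.sub_add_cancel hd₀,
            hd, Equiv.Perm.one_apply] at this
  obtain ⟨p⟩ := hG
  exact key _ x y p.toPath (p.toPath.2.length_lt.le) q h

/-- Some color `y` in the orbit of `x` occurs `2 * d` times. Half of these strands form the cable;
the other half stay behind, so that the remainder still has color `y` and generates. This permits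
recoloring the cable from `y` to `x`. -/
theorem Generates.exists_cable_mul [Fintype X] {d : ℕ} (hd₀ : 0 < d)
    (hd : ∀ x : X, Rack.act' x ^ d = 1) {m : StrandMonoid X ι} (hm : Generates m) (x : X)
    (h : Fintype.card X * (2 * d) ≤ orbitCount (Quot.mk _ x) m) :
    ∃ (l : List ι) (m' : StrandMonoid X ι),
      l.length = d ∧ m = cable x l * m' ∧ Generates m' := by
  classical
  obtain ⟨L, rfl⟩ := exists_list m
  obtain ⟨y, hy, hk⟩ := exists_color_le_count _ L _ h
  obtain ⟨l, m, hl, hL⟩ := StrandMonoid.exists_cable_mul y L _ hk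
  rw [← List.take_append_drop d l, cable_append, mul_assoc] at hL
  have h₁ : (l.take d).length = d := by simp [hl]; omega
  have hg : Generates (cable y (l.drop d) * m) := by
    intro S hS h
    refine hm S hS ?_
    have hyS : y ∈ S := by
      rw [map_mul] at h
      have h' := Nat.eq_one_of_mul_eq_one_right h
      obtain ⟨a, t, ht⟩ := List.exists_cons_of_length_pos
        (show 0 < (l.drop d).length by simp [hl]; omega)
      rw [ht, cable_cons, map_mul] at h'
      exact mem_of_colorsIn_strand hS (Nat.eq_one_of_mul_eq_one_right h')
    rw [hL, map_mul, h, colorsIn_cable hS hyS]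
  exact ⟨l.take d, _, h₁, by rw [hL, hg.cable_mul_eq hd hy h₁], hg⟩

theorem Generates.exists_isCableProd_mul [Fintype X] {d : ℕ} (hd₀ : 0 < d)
    (hd : ∀ x : X, Rack.act' x ^ d = 1) (W : List X) {m : StrandMonoid X ι} (hm : Generates m)
    (h : ∀ c, (W.length + 2 * Fintype.card X) * d ≤ orbitCount c m) :
    ∃ q m' : StrandMonoid X ι, IsCableProd ι d W q ∧ m = q * m' := by
  induction W generalizing m with
  | nil => exact ⟨1, m, .nil, (one_mul m).symm⟩
  | cons x W ih =>
    obtain ⟨l, m, hl, rfl, hg⟩ := hm.exists_cable_mul hd₀ hd x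
      -- The reserve `2 * |X| * d` feeds the pigeonhole step, and each removed cable costs an orbit
      -- at most `d` strands.
      (le_trans (by rw [List.length_cons]; nlinarith [Nat.zero_le ((W.length + 1) * d)]) (h _))
    obtain ⟨q, m, hq, rfl⟩ := ih hg fun c => by
      have h₁ := h c
      have h₂ := orbitCount_cable_le c x l
      rw [orbitCount_mul, List.length_cons] at h₁
      rw [hl] at h₂
      nlinarith
    exact ⟨_, m, .cons x l W q hl hq, (mul_assoc _ _ _).symm⟩

end StrandMonoid

end Quandle

/-! ### Relabelling and transpositions of labels. -/

section Quandle

variable {X : Type*} [Quandle X] {ι : Type*}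

namespace StrandMonoid

/-- The multiset of the labels that occur. -/
def labels (m : StrandMonoid X ι) : Multiset ι := (content m).toAdd.map Prod.snd

@[simp]
theorem labels_mul (m m' : StrandMonoid X ι) : labels (m * m') = labels m + labels m' := by
  simp [labels]

@[simp]
theorem labels_strand (x : X) (a : ι) : labels (strand x a) = {a} := by
  simp [labels]

/-- The endomorphism that changes the labels. -/
def relabel (σ : ι → ι) : StrandMonoid X ι →* StrandMonoid X ι :=
  lift (fun x a => strand x (σ a)) fun x y a b => strand_mul_strand x y (σ a) (σ b)

@[simp]
theorem relabel_strand (σ : ι → ι) (x : X) (a : ι) :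
    relabel σ (strand x a) = strand x (σ a) := rfl

theorem relabel_relabel (σ τ : ι → ι) (m : StrandMonoid X ι) :
    relabel σ (relabel τ m) = relabel (σ ∘ τ) m := by
  obtain ⟨L, rfl⟩ := exists_list m
  induction L with
  | nil => simp
  | cons p L ih => simp [ih]

theorem relabel_eq_self {σ : ι → ι} {m : StrandMonoid X ι} (h : ∀ a ∈ labels m, σ a = a) :
    relabel σ m = m := by
  obtain ⟨L, rfl⟩ := exists_list m
  induction L with
  | nil => simp
  | cons p L ih =>
    rw [List.map_cons, List.prod_cons, labels_mul, labels_strand] at h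
    rw [List.map_cons, List.prod_cons, map_mul, ih fun a ha => h a (Multiset.mem_add.2 (.inr ha)),
      relabel_strand, h p.2 (by simp)]

/-- The permutations of the labels that fix the element. -/
def labelStabilizer (m : StrandMonoid X ι) : Subgroup (Equiv.Perm ι) where
  carrier := {σ | relabel σ m = m}
  one_mem' := relabel_eq_self fun _ _ => rfl
  mul_mem' {σ τ} hσ hτ := by
    have h := relabel_relabel σ τ m
    rw [hτ, hσ] at h
    exact h.symm
  inv_mem' {σ} hσ := by
    have h := relabel_relabel (σ⁻¹ : Equiv.Perm ι) σ m
    rw [hσ] at h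
    exact h.trans (relabel_eq_self fun a _ => by simp)

theorem exists_strand_of_mem_content {m : StrandMonoid X ι} {c : QuandleOrbit X} {a : ι}
    (h : (c, a) ∈ (content m).toAdd) :
    ∃ (x : X) (m₁ m₂ : StrandMonoid X ι), Quot.mk _ x = c ∧ m = m₁ * strand x a * m₂ := by
  obtain ⟨L, rfl⟩ := exists_list m
  rw [content_prod] at h
  obtain ⟨p, hp, h⟩ := Multiset.mem_map.1 h
  obtain ⟨rfl, rfl⟩ := Prod.ext_iff.1 h
  obtain ⟨L₁, L₂, rfl⟩ := List.append_of_mem (Multiset.mem_coe.1 hp)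
  exact ⟨p.1, (L₁.map fun p => strand p.1 p.2).prod, (L₂.map fun p => strand p.1 p.2).prod, rfl,
    by simp [mul_assoc]⟩

/-- Everything between the two strands is still rich, so `Transports.swap` exchanges their labels;
since labels are distinct, the transposition affects no other strand. -/
theorem swap_mem_labelStabilizer [DecidableEq ι] {p q r : StrandMonoid X ι}
    (hn : (labels (p * q * r)).Nodup) (hq : Rich q) {c : QuandleOrbit X} {a b : ι}
    (ha : (c, a) ∈ (content p).toAdd) (hb : (c, b) ∈ (content r).toAdd) :
    Equiv.swap a b ∈ labelStabilizer (p * q * r) := by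
  obtain ⟨x, p₁, p₂, hx, rfl⟩ := exists_strand_of_mem_content ha
  obtain ⟨y, r₁, r₂, hy, rfl⟩ := exists_strand_of_mem_content hb
  have e : p₁ * strand x a * p₂ * q * (r₁ * strand y b * r₂) =
      p₁ * (strand x a * (p₂ * q * r₁) * strand y b) * r₂ := by simp only [mul_assoc]
  rw [e] at hn ⊢
  have hr : Rich (p₂ * q * r₁) := (hq.mul_left p₂).mul_right r₁
  generalize p₂ * q * r₁ = q' at hn hr
  rw [Multiset.nodup_iff_count_le_one] at hn
  have hca := hn a
  have hcb := hn b
  simp only [labels_mul, labels_strand, Multiset.count_add, Multiset.count_singleton,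
    if_true] at hca hcb
  have hfix : ∀ m : StrandMonoid X ι, (labels m).count a = 0 → (labels m).count b = 0 →
      relabel (Equiv.swap a b) m = m := by
    intro m h₁ h₂
    refine relabel_eq_self fun i hi => Equiv.swap_apply_of_ne_of_ne ?_ ?_
    · rintro rfl; exact Multiset.count_eq_zero.1 h₁ hi
    · rintro rfl; exact Multiset.count_eq_zero.1 h₂ hi
  change relabel (Equiv.swap a b) _ = _
  simp only [map_mul, relabel_strand, Equiv.swap_apply_left, Equiv.swap_apply_right]
  rw [hfix p₁ (by omega) (by omega), hfix q' (by omega) (by omega),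
    hfix r₂ (by omega) (by omega), ← (hr x y (hx.trans hy.symm)).swap]

theorem IsCableProd.exists_mem_content {d : ℕ} (hd : 0 < d) {W : List X} {q : StrandMonoid X ι}
    (h : IsCableProd ι d W q) {x : X} (hx : x ∈ W) :
    ∃ a : ι, (Quot.mk _ x, a) ∈ (content q).toAdd := by
  obtain ⟨q₁, q₂, l, rfl, rfl⟩ := h.exists_eq_of_mem hx
  obtain ⟨a, t, rfl⟩ := List.exists_cons_of_length_pos hd
  exact ⟨a, by simp⟩

/-- A group generated by transpositions contains every finitely supported permutation that preserves
its orbits. -/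
theorem mem_of_forall_swap_mem [Finite ι] [DecidableEq ι] {C : Type*} (f : ι → C)
    (H : Subgroup (Equiv.Perm ι)) (h : ∀ a b, f a = f b → Equiv.swap a b ∈ H)
    {σ : Equiv.Perm ι} (hσ : ∀ a, f (σ a) = f a) : σ ∈ H := by
  let S : Set (Equiv.Perm ι) := {τ | ∃ a b, a ≠ b ∧ f a = f b ∧ τ = Equiv.swap a b}
  have hS : Subgroup.closure S ≤ H := by
    rw [Subgroup.closure_le]
    rintro _ ⟨a, b, -, hab, rfl⟩
    exact h a b hab
  refine hS ((mem_closure_isSwap ?_).2 ⟨Set.toFinite _, fun a => ?_⟩)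
  · rintro _ ⟨a, b, hne, -, rfl⟩
    exact ⟨a, b, hne, rfl⟩
  · by_cases ha : σ a = a
    · rw [ha]
      exact MulAction.mem_orbit_self a
    · exact ⟨⟨Equiv.swap a (σ a), Subgroup.subset_closure ⟨a, σ a, Ne.symm ha, (hσ a).symm, rfl⟩⟩,
        Equiv.swap_apply_left a (σ a)⟩

theorem Generates.relabel_eq [Fintype X] [Finite ι] {d : ℕ} (hd₀ : 0 < d)
    (hd : ∀ x : X, Rack.act' x ^ d = 1) {m : StrandMonoid X ι} (hm : Generates m)
    (h : ∀ c, ((2 * Fintype.card X + 2) * Fintype.card X + 2 * Fintype.card X) * d ≤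
      orbitCount c m)
    (hn : (labels m).Nodup) (f : ι → QuandleOrbit X) (hf : ∀ a, (f a, a) ∈ (content m).toAdd)
    {σ : Equiv.Perm ι} (hσ : ∀ a, f (σ a) = f a) : relabel σ m = m := by
  classical
  refine mem_of_forall_swap_mem f (labelStabilizer m) ?_ hσ
  let U : List X := Finset.univ.toList
  have hU : ∀ x, x ∈ U := by simp [U]
  let V : List X := (List.replicate (Fintype.card X) U).flatten
  have hV : V.length = Fintype.card X * Fintype.card X := by simp [V, U]
  obtain ⟨q₀, m₀, hq₀, rfl⟩ := hm.exists_isCableProd_mul hd₀ hd (U ++ (V ++ (V ++ U)))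
    (fun c => le_of_eq_of_le (by congr 1; simp [hV, U]; ring) (h c))
  obtain ⟨A, q₁, hA, hq₁, rfl⟩ := hq₀.exists_mul
  obtain ⟨q, q₂, hq, hq₂, rfl⟩ := hq₁.exists_mul
  obtain ⟨q', C, hq', hC, rfl⟩ := hq₂.exists_mul
  have e₁ : A * (q * (q' * C)) * m₀ = A * q * (q' * (C * m₀)) := by simp only [mul_assoc]
  have e₂ : A * (q * (q' * C)) * m₀ = A * q * q' * (C * m₀) := by simp only [mul_assoc]
  -- For each orbit, a label `j` in the last block `C` serves as a hub. A label left of `q'` is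
  -- exchanged with `j` across `q'`; any other label lies right of `q`, and reaches `j` through a
  -- label `i` in `A`, across `q` and then `q'`.
  have key : ∀ c, ∃ i, ∀ a, f a = c →
      Equiv.swap a i ∈ labelStabilizer (A * (q * (q' * C)) * m₀) := by
    intro c
    obtain ⟨x, rfl⟩ := Quot.exists_rep c
    obtain ⟨i, hi⟩ := hA.exists_mem_content hd₀ (hU x)
    obtain ⟨j, hj⟩ := hC.exists_mem_content hd₀ (hU x)
    have hj' : (Quot.mk _ x, j) ∈ (content (C * m₀)).toAdd := by simp [hj]
    have hi' : (Quot.mk _ x, i) ∈ (content (A * q)).toAdd := by simp [hi]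
    refine ⟨j, fun a ha => ?_⟩
    have hfa := hf a
    rw [ha, e₁, map_mul, toAdd_mul, Multiset.mem_add] at hfa
    obtain hfa | hfa := hfa
    · rw [e₂] at hn ⊢
      exact swap_mem_labelStabilizer hn (hq'.rich hd₀ hd hU) hfa hj'
    · have hij : Equiv.swap i j ∈ labelStabilizer (A * (q * (q' * C)) * m₀) := by
        rw [e₂] at hn ⊢
        exact swap_mem_labelStabilizer hn (hq'.rich hd₀ hd hU) hi' hj'
      refine SubmonoidClass.swap_mem_trans _ ?_ hij
      rw [Equiv.swap_comm]
      rw [e₁] at hn ⊢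
      exact swap_mem_labelStabilizer hn (hq.rich hd₀ hd hU) hi hfa
  intro a b hab
  obtain ⟨i, hi⟩ := key (f b)
  refine SubmonoidClass.swap_mem_trans _ (hi a hab) ?_
  rw [Equiv.swap_comm]
  exact hi b rfl

end StrandMonoid

end Quandle

/-! ### Tuples as elements of the monoid. -/

section Quandle

namespace StrandMonoid

variable {X : Type*} [Quandle X] {ι : Type*}

theorem mem_of_colorsIn_prod {S : Set X} (hS : IsSubquandle S) (L : List (X × ι))
    (h : colorsIn hS (L.map fun p => strand p.1 p.2).prod = 1) : ∀ p ∈ L, p.1 ∈ S := by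
  induction L with
  | nil => simp
  | cons p L ih =>
    rw [List.map_cons, List.prod_cons, map_mul] at h
    rintro q hq
    obtain rfl | hq := List.mem_cons.1 hq
    · exact mem_of_colorsIn_strand hS (Nat.eq_one_of_mul_eq_one_right h)
    · exact ih (Nat.eq_one_of_mul_eq_one_left h) q hq

/-- The product of the strands with the given colors and labels. -/
def ofTuple {n : ℕ} (s : Fin n → X) (f : Fin n → ι) : StrandMonoid X ι :=
  ((List.ofFn fun i => (s i, f i)).map fun p => strand p.1 p.2).prod

theorem relabel_ofTuple {n : ℕ} (s : Fin n → X) (f : Fin n → ι) (σ : ι → ι) :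
    relabel σ (ofTuple s f) = ofTuple s (σ ∘ f) := by
  simp [ofTuple, map_list_prod, List.map_ofFn, Function.comp_def]

theorem content_ofTuple {n : ℕ} (s : Fin n → X) (f : Fin n → ι) :
    (content (ofTuple s f)).toAdd =
      (Finset.univ : Finset (Fin n)).val.map fun i => (Quot.mk _ (s i), f i) := by
  rw [ofTuple, content_prod, Fin.univ_val_map, Multiset.map_coe, List.map_ofFn]
  rfl

theorem labels_ofTuple {n : ℕ} (s : Fin n → X) (f : Fin n → ι) :
    labels (ofTuple s f) = (Finset.univ : Finset (Fin n)).val.map f := by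
  rw [labels, content_ofTuple, Multiset.map_map]
  rfl

theorem orbitCount_ofTuple {n : ℕ} (s : Fin n → X) (f : Fin n → ι) (c : QuandleOrbit X) :
    orbitCount c (ofTuple s f) = {i | Quot.mk _ (s i) = c}.ncard := by
  classical
  rw [orbitCount, content_ofTuple, Multiset.map_map, Multiset.count_map,
    Set.ncard_eq_toFinset_card', Set.toFinset_ofPred, Finset.card_def, Finset.filter_val]
  congr 2
  ext i
  exact eq_comm

theorem ofTuple_eq_mk {n : ℕ} (s : Fin n → X) (f : Fin n → ι) :
    ofTuple s f = PresentedMonoid.mk _ (FreeMonoid.ofList (List.ofFn fun i => (s i, f i))) := by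
  rw [ofTuple]
  generalize (List.ofFn fun i => (s i, f i)) = L
  induction L with
  | nil => rfl
  | cons p L ih =>
    rw [FreeMonoid.ofList_cons, map_mul, ← ih, List.map_cons, List.prod_cons]
    rfl

end StrandMonoid

end Quandle

/-! ### Braided sets as quandles. -/

namespace BraidedSet

variable {X : Type u} [BraidedSet X]

/-- The quandle of a squarefree self-distributive braided set. -/
abbrev toQuandle (h : IsSelfDistributive X) (h' : IsSquarefree X) : Quandle X where
  act y x := (R (x, y)).2
  self_distrib {x y z} := by
    -- The third coordinate of the Yang–Baxter equation at the reversed triple is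
    -- self-distributivity.
    have e := congrFun yang_baxter (z, y, x)
    simp only [Function.comp_apply, prodId, idProd, Prod.ext_iff] at e
    obtain ⟨-, -, e⟩ := e
    simpa only [h _ _] using e
  invAct y x := (R.symm (y, x)).1
  left_inv y x := by
    have e : (y, (R (x, y)).2) = R (x, y) := Prod.ext (h x y).symm rfl
    change (R.symm (y, (R (x, y)).2)).1 = x
    rw [e, Equiv.symm_apply_apply]
  right_inv y x := by
    have e := h (R.symm (y, x)).1 (R.symm (y, x)).2
    rw [Prod.mk.eta, Equiv.apply_symm_apply] at e
    change (R ((R.symm (y, x)).1, y)).2 = x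
    simp only at e
    nth_rw 2 [e]
    rw [Prod.mk.eta, Equiv.apply_symm_apply]
  fix {x} := by rw [h']

theorem component_eq_iff [Quandle X] (hR : ∀ x y : X, R (x, y) = (y, y ◃ x)) {x y : X} :
    component x = component y ↔ (Quot.mk _ x : QuandleOrbit X) = Quot.mk _ y := by
  constructor
  · intro h
    induction (Quotient.exact h : Relation.EqvGen _ x y) with
    | rel a b hab =>
      obtain ⟨y, z, e⟩ | ⟨y, z, e⟩ := hab
      · rw [hR, Prod.mk.injEq] at e
        rw [← e.2, QuandleOrbit.mk_act]
      · rw [hR, Prod.mk.injEq] at e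
        rw [e.1]
    | refl => rfl
    | symm a b hab ih => exact (ih h.symm).symm
    | trans a b c hab hbc ih ih' =>
      have e : component a = component b := Quotient.sound hab
      exact (ih e).trans (ih' (e.symm.trans h))
  · intro h
    induction Quot.eqvGen_exact h with
    | rel a b hab =>
      obtain ⟨z, rfl⟩ := hab
      exact Quotient.sound (.rel _ _ (.inl ⟨z, z, hR a z⟩))
    | refl => rfl
    | symm a b hab ih => exact (ih h.symm).symm
    | trans a b c hab hbc ih ih' =>
      have e : (Quot.mk _ a : QuandleOrbit X) = Quot.mk _ b := Quot.eqvGen_sound hab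
      exact (ih e).trans (ih' (e.symm.trans h))

theorem isBraidedSubset_of_isSubquandle [Quandle X] (hR : ∀ x y : X, R (x, y) = (y, y ◃ x))
    {S : Set X} (hS : IsSubquandle S) : IsBraidedSubset S := by
  refine ⟨?_, R.injective.injOn, ?_⟩
  · rintro ⟨x, y⟩ ⟨hx, hy⟩
    rw [hR]
    exact ⟨hy, (hS y hy x).2 hx⟩
  · rintro ⟨y, z⟩ ⟨hy, hz⟩
    obtain ⟨x, rfl⟩ := (Rack.act' y).surjective z
    exact ⟨(x, y), ⟨(hS y hy x).1 hz, hy⟩, hR x y⟩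

theorem generates_ofTuple [Quandle X] (hR : ∀ x y : X, R (x, y) = (y, y ◃ x)) {ι : Type*} {n : ℕ}
    {s : Fin n → X} (hs : generated (Set.range s) = Set.univ) (f : Fin n → ι) :
    (StrandMonoid.ofTuple s f).Generates := by
  intro S hS h
  rw [← Set.univ_subset_iff, ← hs]
  refine Set.sInter_subset_of_mem ⟨isBraidedSubset_of_isSubquandle hR hS, ?_⟩
  rintro _ ⟨i, rfl⟩
  exact StrandMonoid.mem_of_colorsIn_prod hS _ h (s i, f i) ((List.mem_ofFn' _ _).2 ⟨i, rfl⟩)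

theorem mem_productSubgroup_iff {n : ℕ} {s : Fin n → X} {σ : Equiv.Perm (Fin n)} :
    σ ∈ productSubgroup s ↔ ∀ i, component (s (σ i)) = component (s i) := by
  constructor
  · intro h i
    have hi : σ i ∈ σ '' indices s (component (s i)) := ⟨i, rfl, rfl⟩
    rwa [h] at hi
  · intro h c
    ext j
    constructor
    · rintro ⟨i, hi, rfl⟩
      exact (h i).trans hi
    · intro hj
      refine ⟨σ.symm j, ?_, σ.apply_symm_apply j⟩
      have := h (σ.symm j)
      rw [σ.apply_symm_apply] at this
      exact this.symm.trans hj

end BraidedSet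

/-! ### Braids and equality in the monoid. -/

namespace BraidGroup

open BraidedSet

variable {X : Type u} [BraidedSet X]

@[simp]
theorem act_one {n : ℕ} (s : Fin n → X) : act s 1 = s := by
  simp [act]

theorem act_mul {n : ℕ} (s : Fin n → X) (g h : BraidGroup n) :
    act s (g * h) = act (act s g) h := by
  simp [act]

theorem act_of {n : ℕ} (s : Fin n → X) (i : BraidIndex n) :
    act s (PresentedGroup.of i) = applyAt R i s := by
  simp [act, rightAction, generatorPerm]

theorem toPerm_of {n : ℕ} (i : BraidIndex n) :
    toPerm n (PresentedGroup.of i) = Equiv.swap i.left i.right := by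
  simp [toPerm]

theorem component_act {n : ℕ} (g : BraidGroup n) (s : Fin n → X) (i : Fin n) :
    component (act s g i) = component (s (toPerm n g i)) := by
  have hg : g ∈ Subgroup.closure (Set.range (PresentedGroup.of (rels := braidRelators n))) := by
    rw [PresentedGroup.closure_range_of]
    trivial
  induction hg using Subgroup.closure_induction generalizing s i with
  | mem x hx =>
    obtain ⟨j, rfl⟩ := hx
    rw [act_of, toPerm_of, applyAt, Equiv.swap_apply_def]
    have h₁ : component (R (s j.left, s j.right)).1 = component (s j.right) :=
      (Quotient.sound (Relation.EqvGen.rel _ _ (.inr ⟨_, _, rfl⟩))).symm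
    have h₂ : component (R (s j.left, s j.right)).2 = component (s j.left) :=
      (Quotient.sound (Relation.EqvGen.rel _ _ (.inl ⟨_, _, rfl⟩))).symm
    split_ifs
    · exact h₁
    · exact h₂
    · rfl
  | one => simp
  | mul x y _ _ hx hy => rw [act_mul, hy, hx, map_mul, Equiv.Perm.mul_apply]
  | inv x _ hx =>
    have h := hx (act s x⁻¹) ((toPerm n x)⁻¹ i)
    rw [← act_mul, inv_mul_cancel, act_one] at h
    rw [map_inv, h]
    simp

/-- Two lists of labelled elements that are related by the action of a braid. -/
def BraidRel {ι : Type*} (l l' : List (X × ι)) : Prop :=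
  ∃ (n : ℕ) (s : Fin n → X) (f : Fin n → ι) (g : BraidGroup n),
    l = List.ofFn (fun i => (s i, f i)) ∧ l' = List.ofFn fun i => (act s g i, f (toPerm n g i))

theorem BraidRel.exists_of_ofFn {ι : Type*} {n : ℕ} {s : Fin n → X} {f : Fin n → ι}
    {l : List (X × ι)} (h : BraidRel (List.ofFn fun i => (s i, f i)) l) :
    ∃ g : BraidGroup n, l = List.ofFn fun i => (act s g i, f (toPerm n g i)) := by
  obtain ⟨n', s', f', g, h, rfl⟩ := h
  obtain rfl : n = n' := by simpa using congrArg List.length h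
  have e := List.ofFn_injective h
  obtain rfl : s = s' := funext fun i => congrArg Prod.fst (congrFun e i)
  obtain rfl : f = f' := funext fun i => congrArg Prod.snd (congrFun e i)
  exact ⟨g, rfl⟩

theorem BraidRel.refl {ι : Type*} (l : List (X × ι)) : BraidRel l l :=
  ⟨l.length, fun i => (l.get i).1, fun i => (l.get i).2, 1, by simp, by simp⟩

theorem BraidRel.symm {ι : Type*} {l l' : List (X × ι)} (h : BraidRel l l') : BraidRel l' l := by
  obtain ⟨n, s, f, g, rfl, rfl⟩ := h
  exact ⟨n, act s g, f ∘ toPerm n g, g⁻¹, rfl, by simp [← act_mul]⟩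

theorem BraidRel.trans {ι : Type*} {l₁ l₂ l₃ : List (X × ι)} (h : BraidRel l₁ l₂)
    (h' : BraidRel l₂ l₃) : BraidRel l₁ l₃ := by
  obtain ⟨n, s, f, g, rfl, rfl⟩ := h
  obtain ⟨g', rfl⟩ := h'.exists_of_ofFn (f := f ∘ toPerm n g)
  exact ⟨n, s, f, g * g', rfl, by simp [act_mul]⟩

theorem braidRel_cross {ι : Type*} (u v : List (X × ι)) (x y : X) (a b : ι) :
    BraidRel (u ++ (x, a) :: (y, b) :: v)
      (u ++ ((R (x, y)).1, b) :: ((R (x, y)).2, a) :: v) := by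
  let l := u ++ (x, a) :: (y, b) :: v
  refine ⟨l.length, fun i => (l.get i).1, fun i => (l.get i).2,
    PresentedGroup.of ⟨u.length, by simp [l]⟩, (List.ofFn_get l).symm, ?_⟩
  rw [act_of, toPerm_of]
  refine List.ext_getElem (by simp [l, add_assoc]) fun k h₁ h₂ => ?_
  simp only [List.getElem_ofFn, applyAt, Equiv.swap_apply_def, BraidIndex.left, BraidIndex.right,
    Fin.ext_iff, List.get_eq_getElem, l]
  obtain h | rfl | rfl | h : k < u.length ∨ k = u.length ∨ k = u.length + 1 ∨ u.length + 2 ≤ k := by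
    omega
  · simp [h, h.ne, show k ≠ u.length + 1 by omega]
  · simp
  · simp
  · obtain ⟨j, rfl⟩ := Nat.exists_eq_add_of_le h
    simp [List.getElem_append_right, add_assoc, add_comm 2]

/-- One crossing of neighbours in a list of labelled elements. -/
inductive CrossStep (X ι : Type*) [BraidedSet X] : List (X × ι) → List (X × ι) → Prop
  | cross (u v : List (X × ι)) (x y : X) (a b : ι) :
      CrossStep X ι (u ++ (x, a) :: (y, b) :: v)
        (u ++ ((R (x, y)).1, b) :: ((R (x, y)).2, a) :: v)

theorem CrossStep.append {ι : Type*} (u v : List (X × ι)) {l l' : List (X × ι)}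
    (h : Relation.EqvGen (CrossStep X ι) l l') :
    Relation.EqvGen (CrossStep X ι) (u ++ l ++ v) (u ++ l' ++ v) := by
  induction h with
  | rel _ _ h =>
    obtain ⟨u', v', x, y, a, b⟩ := h
    have := CrossStep.cross (u ++ u') (v' ++ v) x y a b
    exact .rel _ _ (by simpa using this)
  | refl => exact .refl _
  | symm _ _ _ ih => exact ih.symm
  | trans _ _ _ _ _ ih ih' => exact ih.trans _ _ _ ih'

theorem CrossStep.braidRel {ι : Type*} {l l' : List (X × ι)}
    (h : Relation.EqvGen (CrossStep X ι) l l') : BraidRel l l' := by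
  induction h with
  | rel _ _ h =>
    obtain ⟨u, v, x, y, a, b⟩ := h
    exact braidRel_cross u v x y a b
  | refl => exact .refl _
  | symm _ _ _ ih => exact ih.symm
  | trans _ _ _ _ _ ih ih' => exact ih.trans ih'

/-- The congruence on the free monoid that is generated by crossings. -/
def crossCon (X ι : Type*) [BraidedSet X] : Con (FreeMonoid (X × ι)) where
  r l l' := Relation.EqvGen (CrossStep X ι) l.toList l'.toList
  iseqv := ⟨fun _ => .refl _, fun h => h.symm, fun h h' => h.trans _ _ _ h'⟩
  mul' {w x y z} h h' := by
    have h₁ := CrossStep.append [] y.toList h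
    have h₂ := CrossStep.append x.toList [] h'
    rw [List.nil_append, List.nil_append] at h₁
    rw [List.append_nil, List.append_nil] at h₂
    exact h₁.trans _ _ _ h₂

/-- Equivalence under crossings is a congruence containing the defining relations, hence also the
congruence that they generate; each crossing is realized by a braid generator. -/
theorem braidRel_of_ofTuple_eq [Quandle X] (hR : ∀ x y : X, R (x, y) = (y, y ◃ x)) {ι : Type*}
    {n : ℕ} {s s' : Fin n → X} {f f' : Fin n → ι}
    (h : StrandMonoid.ofTuple s f = StrandMonoid.ofTuple s' f') :
    BraidRel (List.ofFn fun i => (s i, f i)) (List.ofFn fun i => (s' i, f' i)) := by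
  rw [StrandMonoid.ofTuple_eq_mk, StrandMonoid.ofTuple_eq_mk, PresentedMonoid.mk_eq_mk_iff] at h
  have hle : conGen (StrandRel X ι) ≤ crossCon X ι := by
    refine Con.conGen_le.2 ?_
    rintro _ _ ⟨x, y, a, b⟩
    have := CrossStep.cross [] [] x y a b
    rw [hR] at this
    exact .rel _ _ this
  exact CrossStep.braidRel (hle h)

end BraidGroup

/-! ### The corollary. -/

theorem mainTheorem4 :
    ∃ N : ℕ → ℕ, ∀ (X : Type u) [Finite X] [BraidedSet X],
      BraidedSet.IsSelfDistributive X → BraidedSet.IsSquarefree X →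
      ∀ (n : ℕ) (s : Fin n → X),
        (∀ c : BraidedSet.Components X, N (Nat.card X) ≤ (BraidedSet.indices s c).ncard) →
        BraidedSet.generated (Set.range s) = Set.univ →
        (BraidGroup.stabilizer s).map (BraidGroup.toPerm n) = BraidedSet.productSubgroup s ∧
        (BraidGroup.stabilizer s ⊓ BraidedSet.coloredBraidGroup s).map (BraidGroup.toPerm n) =
          BraidedSet.productSubgroup s := by
  -- The word `U V V U` has `2 * k + 2 * k ^ 2` letters, each a cable of `k!` strands; the summand
  -- `2 * k` is the pigeonhole reserve.
  refine ⟨fun k => ((2 * k + 2) * k + 2 * k) * k.factorial, ?_⟩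
  intro X _ _ h h' n s hN hs
  let _ : Quandle X := BraidedSet.toQuandle h h'
  have hR : ∀ x y : X, BraidedSet.R (x, y) = (y, y ◃ x) := fun x y => Prod.ext (h x y) rfl
  have _ := Fintype.ofFinite X
  have hle : (BraidGroup.stabilizer s).map (BraidGroup.toPerm n) ≤
      BraidedSet.productSubgroup s := by
    rintro _ ⟨g, hg, rfl⟩
    refine BraidedSet.mem_productSubgroup_iff.2 fun i => ?_
    rw [← BraidGroup.component_act, show BraidGroup.act s g = s from hg]
  have heq : (BraidGroup.stabilizer s).map (BraidGroup.toPerm n) =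
      BraidedSet.productSubgroup s := by
    refine le_antisymm hle fun σ hσ => ?_
    have hd : ∀ x : X, Rack.act' x ^ (Fintype.card X).factorial = 1 := fun x => by
      classical
      rw [← Fintype.card_perm, pow_card_eq_one]
    have hrel : StrandMonoid.relabel σ (StrandMonoid.ofTuple s id) = StrandMonoid.ofTuple s id := by
      refine (BraidedSet.generates_ofTuple hR hs id).relabel_eq (Nat.factorial_pos _) hd
        (fun c => ?_) ?_ (fun i => Quot.mk _ (s i)) (fun i => ?_) fun i => ?_
      · obtain ⟨x, rfl⟩ := Quot.exists_rep c
        have hx := hN (BraidedSet.component x)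
        rw [Nat.card_eq_fintype_card] at hx
        rw [StrandMonoid.orbitCount_ofTuple]
        simpa only [BraidedSet.indices, BraidedSet.component_eq_iff hR] using hx
      · rw [StrandMonoid.labels_ofTuple, Multiset.map_id]
        exact Finset.univ.nodup
      · rw [StrandMonoid.content_ofTuple]
        exact Multiset.mem_map.2 ⟨i, Finset.mem_univ i, rfl⟩
      · exact (BraidedSet.component_eq_iff hR).1 (BraidedSet.mem_productSubgroup_iff.1 hσ i)
    rw [StrandMonoid.relabel_ofTuple] at hrel
    -- The colors of the two labelled tuples show that `g` fixes `s`, and the labels show that its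
    -- permutation is `σ`.
    obtain ⟨g, hg⟩ := (BraidGroup.braidRel_of_ofTuple_eq hR hrel.symm).exists_of_ofFn
    have e := List.ofFn_injective hg
    refine ⟨g, funext fun i => (congrArg Prod.fst (congrFun e i)).symm, ?_⟩
    exact Equiv.ext fun i => (congrArg Prod.snd (congrFun e i)).symm
  refine ⟨heq, ?_⟩
  -- The upper bound says that the stabilizer already lies in the colored braid group.
  rw [BraidedSet.coloredBraidGroup, inf_eq_left.2 (Subgroup.map_le_iff_le_comap.1 hle), heq]
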